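/- **Setting.** A centralized matching market has players $p_1,\dots,p_N$ and arms $a_1,\dots,a_K$; a matching is an injective map $m$ from players to arms (so $N\le K$). Arm $a_k$ has fixed, known utilities $\pi_k(i)$ over players. In round $t\in\{1,\dots,T\}$ player $p_i$ has unknown mean rewards $\mu_{i,t}(k)$ with $|\mu_{i,t}(k)|\le\bar\mu$ and $|\mu_{i,t}(k)-\mu_{i,t}(k')|\ge\Delta>0$ for all $k\ne k'$. The number of changes is $$L_T=\sum_{t=2}^T\sum_{i}\sum_{j}\mathbb 1[\mu_{i,t}(j)\neq\mu_{i,t-1}(j)],\qquad\text{and } L_T\ge 1.$$ A pair $(p_i,a_k)$ blocks $m$ if $p_i$ strictly prefers $a_k$ to $m(i)$ and $a_k$ is unmatched or strictly prefers $p_i$ to its partner; $m$ is stable if no pair blocks it. A valid partner of a player is an arm it is matched with in some stable matching. A player-optimal (player-pessimal) matching gives every player its most (least) preferred valid partner. When player $p_i$ is matched with arm $m_t(i)$ in round $t$ it receives a reward $X_{i,t}$ which, conditionally on the information available when $m_t$ is chosen, has mean $\mu_{i,t}(m_t(i))$ and is sub-Gaussian with variance proxy $\sigma^2$: $\mathbb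 E[e^{s(X_{i,t}-\mu_{i,t}(m_t(i)))}\mid\cdot]\le e^{\sigma^2s^2/2}$ for all real $s$. **Algorithm (Restart Competing Bandits, confidence parameter $\alpha>0$).** The horizon is divided into intervals of $H$ rounds, where $H$ is $L_T^{-1/2}T^{1/2}$ rounded (up or down) to a positive integer; all statistics are reset at the first round $S_t$ of the interval containing $t$. With $T_{i,t}(j)$ the number of rounds in $[S_t,t-1]$ in which $p_i$ was matched with $a_j$ and $\hat\mu_{i,t}(j)$ the mean of the corresponding rewards, set $u_{i,t}(j)=\infty$ if $T_{i,t}(j)=0$ and otherwise $$u_{i,t}(j)=\hat\mu_{i,t}(j)+\sqrt{\frac{\alpha\log(t-S_t)}{T_{i,t}(j)}}.$$ In round $t$ each player submits a ranking of the arms by decreasing $u_{i,t}$ (ties broken arbitrarily), and the platform applies the player-optimal stable matching $m_t$ for the submitted rankings and the arms' preferences. **Theorem.** Let $\alpha\ge 2\sigma^2$ (for example $\alpha=3/2$ and rewards in $[0,1]$, for which $\sigma^2=1/4$; or $\sigma=1$ and $\alpha\ge 2$). There is a constant $C$ that depends only on $N,K,\bar\mu$ and $\alpha$ such that, for every such market,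 horizon and run of the algorithm, every player-pessimal matching $\underline m_t$ for $\mu_{\cdot,t}$, $\pi$ ($1\le t\le T$), and every player $p_i$, the player-pessimal regret satisfies $$R^i_T=\sum_{t=1}^T\mu_{i,t}(\underline m_t(i))-\mathbb E\sum_{t=1}^T\mu_{i,t}(m_t(i))\;\le\; C\,L_T^{1/2}T^{1/2}\Big(1+\frac1{\Delta^2}\Big)(1+\log T),$$ that is, $R^i_T=\widetilde O\big(L_T^{1/2}T^{1/2}(1+1/\Delta^2)\big)$. -/

import Mathlib

open MeasureTheory

noncomputable section

namespace RCB

/-! ## Two-sided matching markets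

Players are `Fin N`, arms are `Fin K`. A preference of an agent is a score function: the agent
prefers the partner with the larger score. Arms score players by real utilities `π`; players score
arms by elements of a linear order `S` (real mean rewards, or positions in a submitted ranking). -/

/-- A matching: an injective assignment of an arm to every player. -/
abbrev Matching (N K : ℕ) : Type := Fin N ↪ Fin K

section Market

variable {N K : ℕ} {S : Type} [LinearOrder S]

/-- `(i, k)` is a blocking pair of `m`: player `i` strictly prefers arm `k` to its partner, and
`k` is unmatched or strictly prefers `i` to its partner. -/
def IsBlockingPair (π : Fin K → Fin N → ℝ) (v : Fin N → Fin K → S) (m : Matching N K)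
    (i : Fin N) (k : Fin K) : Prop :=
  v i (m i) < v i k ∧ ((∀ i', m i' ≠ k) ∨ ∃ i', m i' = k ∧ π k i' < π k i)

/-- A matching is stable if it has no blocking pair. -/
def IsStable (π : Fin K → Fin N → ℝ) (v : Fin N → Fin K → S) (m : Matching N K) : Prop :=
  ∀ i k, ¬ IsBlockingPair π v m i k

/-- Arm `k` is a valid partner of player `i`: some stable matching assigns `k` to `i`. -/
def IsValidPartner (π : Fin K → Fin N → ℝ) (v : Fin N → Fin K → S) (i : Fin N) (k : Fin K) :
    Prop :=
  ∃ m : Matching N K, IsStable π v m ∧ m i = k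

/-- Every player is matched to its most preferred valid partner. -/
def IsPlayerOptimal (π : Fin K → Fin N → ℝ) (v : Fin N → Fin K → S) (m : Matching N K) : Prop :=
  ∀ i, IsValidPartner π v i (m i) ∧ ∀ k, IsValidPartner π v i k → v i k ≤ v i (m i)

/-- Every player is matched to its least preferred valid partner. -/
def IsPlayerPessimal (π : Fin K → Fin N → ℝ) (v : Fin N → Fin K → S) (m : Matching N K) : Prop :=
  ∀ i, IsValidPartner π v i (m i) ∧ ∀ k, IsValidPartner π v i k → v i (m i) ≤ v i k

end Market

/-! ## The time varying environment. Rounds are `1, …, T`. -/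

section Environment

variable {N K : ℕ}

/-- `L_T`: the total number of changes of the mean rewards, over all players and arms. -/
def numChanges (μ : ℕ → Fin N → Fin K → ℝ) (T : ℕ) : ℕ :=
  ∑ t ∈ Finset.Icc 2 T, ∑ i, ∑ j, if μ t i j ≠ μ (t - 1) i j then 1 else 0

/-- The rewards `X t i` received by the players when matched by `m t`. Here `ℱ t` is the
information available when round `t` is cleared, and `X t` is known afterwards. Given `ℱ t`, the
reward of player `i` has mean `μ t i (m t i)` and is sub-Gaussian with variance proxy `σ ^ 2`. -/
structure IsRewardProcess {Ω : Type*} [mΩ : MeasurableSpace Ω] (P : Measure Ω)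
    (ℱ : Filtration ℕ mΩ) (T : ℕ) (σ : ℝ) (μ : ℕ → Fin N → Fin K → ℝ)
    (m : ℕ → Ω → Matching N K) (X : ℕ → Fin N → Ω → ℝ) : Prop where
  /-- The matching of round `t` does not depend on the rewards of rounds `t, t + 1, …`. -/
  matching_measurable : ∀ t ∈ Finset.Icc 1 T, ∀ i, Measurable[ℱ t] (fun ω => m t ω i)
  reward_measurable : ∀ t ∈ Finset.Icc 1 T, ∀ i, Measurable[ℱ (t + 1)] (X t i)
  reward_integrable : ∀ t ∈ Finset.Icc 1 T, ∀ i, Integrable (X t i) P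
  reward_mean : ∀ t ∈ Finset.Icc 1 T, ∀ i,
    P[X t i | ℱ t] =ᵐ[P] fun ω => μ t i (m t ω i)
  exp_integrable : ∀ t ∈ Finset.Icc 1 T, ∀ i, ∀ s : ℝ,
    Integrable (fun ω => Real.exp (s * (X t i ω - μ t i (m t ω i)))) P
  subGaussian : ∀ t ∈ Finset.Icc 1 T, ∀ i, ∀ s : ℝ,
    P[fun ω => Real.exp (s * (X t i ω - μ t i (m t ω i))) | ℱ t]
      ≤ᵐ[P] fun _ => Real.exp (σ ^ 2 * s ^ 2 / 2)

/-- The (expected) agent-stable regret of player `i` over `T` rounds with respect to the benchmark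
matchings `b t`. -/
def agentRegret {Ω : Type*} [MeasurableSpace Ω] (P : Measure Ω) (μ : ℕ → Fin N → Fin K → ℝ)
    (b : ℕ → Matching N K) (m : ℕ → Ω → Matching N K) (T : ℕ) (i : Fin N) : ℝ :=
  ∑ t ∈ Finset.Icc 1 T, μ t i (b t i) - ∫ ω, ∑ t ∈ Finset.Icc 1 T, μ t i (m t ω i) ∂P

end Environment

/-! ## The Restart Competing Bandits algorithm -/

section Algorithm

variable {N K : ℕ}

/-- The first round of the restart interval that contains round `t ≥ 1`; with restart period `H`
the intervals begin at the rounds `1, H + 1, 2 * H + 1, …`. -/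
def lastRestart (H t : ℕ) : ℕ := (t - 1) / H * H + 1

/-- The rounds before `t`, since the last restart, in which player `i` was matched with arm `j`. -/
def pullRounds (H : ℕ) (m : ℕ → Matching N K) (i : Fin N) (j : Fin K) (t : ℕ) : Finset ℕ :=
  (Finset.Ico (lastRestart H t) t).filter fun s => m s i = j

/-- The number of times player `i` was matched with arm `j` since the last restart. -/
def pullCount (H : ℕ) (m : ℕ → Matching N K) (i : Fin N) (j : Fin K) (t : ℕ) : ℕ :=
  (pullRounds H m i j t).card

/-- The mean of the rewards of player `i` from arm `j` since the last restart. -/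
def empiricalMean (H : ℕ) (m : ℕ → Matching N K) (x : ℕ → Fin N → ℝ) (i : Fin N) (j : Fin K)
    (t : ℕ) : ℝ :=
  (∑ s ∈ pullRounds H m i j t, x s i) / pullCount H m i j t

/-- The upper confidence bound of player `i` for arm `j` at the beginning of round `t`, with
confidence parameter `α`. -/
def ucb (α : ℝ) (H : ℕ) (m : ℕ → Matching N K) (x : ℕ → Fin N → ℝ) (i : Fin N) (j : Fin K)
    (t : ℕ) : EReal :=
  if pullCount H m i j t = 0 then ⊤
  else ((empiricalMean H m x i j t +
    √(α * Real.log ((t - lastRestart H t : ℕ) : ℝ) / pullCount H m i j t) : ℝ) : EReal)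

/-- The matchings `m` and submitted rankings `r` (larger position is better) are produced by the
algorithm with restart period `H` from the observed rewards `X`: in every round each player submits
a ranking that orders the arms by their upper confidence bounds (ties broken arbitrarily), and
the platform chooses the player-optimal stable matching for the submitted rankings. -/
structure IsRCBRun {Ω : Type*} (T : ℕ) (α : ℝ) (H : ℕ) (π : Fin K → Fin N → ℝ)
    (r : ℕ → Ω → Fin N → Equiv.Perm (Fin K)) (m : ℕ → Ω → Matching N K)
    (X : ℕ → Fin N → Ω → ℝ) : Prop where
  ranking : ∀ t ∈ Finset.Icc 1 T, ∀ ω i j j',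
    ucb α H (fun s => m s ω) (fun s i => X s i ω) i j' t
        < ucb α H (fun s => m s ω) (fun s i => X s i ω) i j t →
      r t ω i j' < r t ω i j
  stable : ∀ t ∈ Finset.Icc 1 T, ∀ ω, IsStable π (fun i j => r t ω i j) (m t ω)
  optimal : ∀ t ∈ Finset.Icc 1 T, ∀ ω, IsPlayerOptimal π (fun i j => r t ω i j) (m t ω)

end Algorithm

end RCB

end

/-! If a player does worse in `m t` than in the pessimal matching, then `m t` is not stable for the
true means, since otherwise its partner would be a valid one below the pessimal. So some pair (i',
k) truly blocks `m t`. As `m t` is stable for the submitted rankings, i' must rank k no higher than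
its current arm j (`exists_misranked_of_lt_pessimal`). Positive regret thus needs upper confidence
bounds in the wrong order across a true gap of at least Δ.

Such a round has one of three causes. Either the means changed since the last restart, which happens
in at most L·H rounds (`card_not_isFresh_le`). Or j has been observed at most about α log T / Δ²
times since the restart, which happens O(log T / Δ²) times per interval and pair
(`card_pulls_of_small_count`). Or a confidence bound failed: that of k is too low by Δ/2, or the
mean of a well-sampled j is too high by Δ/4.

Failures are controlled by exponential supermartingales of expectation at most 1
(`integral_expMart_le_one`). The number of observations n is random, so the Chernoff bounds are
summed over all n. The margin proportional to Δ makes this sum geometric, of order α/Δ², with an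
extra factor 1/τ (τ the time since restart) for low bounds and 1/T for high means. Over all rounds
these cost about (T/H) log T and a constant. With H near √(T/L), both L·H and T/H are of order
√(LT). -/

namespace RCB

/-! ### Counting rounds: restart intervals, small counts, stale means. -/

section Combinatorics

variable {N K : ℕ}

/-- If a matching is stable for the submitted rankings but leaves a player worse off than in the
pessimal matching of the true preferences, then some player ranks its partner above an arm that it
truly prefers. -/
lemma exists_misranked_of_lt_pessimal {π : Fin K → Fin N → ℝ} {v : Fin N → Fin K → ℝ}
    {r : Fin N → Equiv.Perm (Fin K)} {m b : Matching N K}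
    (hm : IsStable π (fun i j => r i j) m) (hb : IsPlayerPessimal π v b) {i : Fin N}
    (h : v i (m i) < v i (b i)) :
    ∃ i' k, v i' (m i') < v i' k ∧ r i' k ≤ r i' (m i') := by
  have hns : ¬ IsStable π v m := fun hs => absurd ((hb i).2 _ ⟨m, hs, rfl⟩) (not_le.2 h)
  simp only [IsStable, not_forall, not_not] at hns
  obtain ⟨i', k, hlt, hk⟩ := hns
  refine ⟨i', k, hlt, ?_⟩
  by_contra hr
  exact hm i' k ⟨not_le.1 hr, hk⟩

lemma sub_lastRestart (H t : ℕ) : t - lastRestart H t = (t - 1) % H := by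
  have := Nat.div_add_mod' (t - 1) H
  unfold lastRestart
  omega

lemma one_le_lastRestart (H t : ℕ) : 1 ≤ lastRestart H t := by
  unfold lastRestart; omega

lemma lastRestart_le {H t : ℕ} (ht : 1 ≤ t) : lastRestart H t ≤ t := by
  have := Nat.div_mul_le_self (t - 1) H
  unfold lastRestart
  omega

lemma lt_lastRestart_add {H t : ℕ} (hH : 0 < H) : t < lastRestart H t + H := by
  have := Nat.div_add_mod' (t - 1) H
  have := Nat.mod_lt (t - 1) hH
  unfold lastRestart
  omega

lemma pullCount_le (H : ℕ) (m : ℕ → Matching N K) (i : Fin N) (j : Fin K) (t : ℕ) :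
    pullCount H m i j t ≤ (t - 1) % H := by
  refine (Finset.card_filter_le _ _).trans ?_
  rw [Nat.card_Ico, sub_lastRestart]

lemma pullCount_lt_of_lt {H : ℕ} {m : ℕ → Matching N K} {i : Fin N} {j : Fin K} {s t : ℕ}
    (hs : 1 ≤ s) (hst : s < t) (hr : (s - 1) / H = (t - 1) / H) (hm : m s i = j) :
    pullCount H m i j s < pullCount H m i j t := by
  have hr' : lastRestart H s = lastRestart H t := by simp only [lastRestart, hr]
  refine Finset.card_lt_card (Finset.ssubset_iff_subset_ne.2 ⟨?_, ?_⟩)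
  · intro x hx
    simp only [pullRounds, Finset.mem_filter, Finset.mem_Ico] at hx ⊢
    omega
  · intro h
    have : s ∈ pullRounds H m i j s := by
      rw [h]
      simp only [pullRounds, Finset.mem_filter, Finset.mem_Ico]
      exact ⟨⟨hr' ▸ lastRestart_le hs, hst⟩, hm⟩
    simp [pullRounds] at this

/-- A player is matched at most `c + 1` times per restart interval with an arm whose count is at
most `c`. -/
lemma card_pulls_of_small_count (H T c : ℕ) (m : ℕ → Matching N K) (i : Fin N) (j : Fin K) :
    ((Finset.Icc 1 T).filter fun t => m t i = j ∧ pullCount H m i j t ≤ c).card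
      ≤ (T / H + 1) * (c + 1) := by
  -- A round is encoded by its interval and the current count. The code is injective because each
  -- further match with `j` in the same interval strictly raises the count.
  have := Finset.card_le_card_of_injOn
    (s := (Finset.Icc 1 T).filter fun t => m t i = j ∧ pullCount H m i j t ≤ c)
    (t := Finset.range (T / H + 1) ×ˢ Finset.range (c + 1))
    (fun t => ((t - 1) / H, pullCount H m i j t)) ?_ ?_
  · simpa using this
  · intro t ht
    simp only [Finset.coe_filter, Set.mem_ofPred_eq, Finset.mem_Icc] at ht
    have : (t - 1) / H ≤ T / H := Nat.div_le_div_right (by omega)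
    simp only [Finset.coe_product, Set.mem_prod, Finset.coe_range, Set.mem_Iio]
    omega
  · intro s hs t ht hst
    simp only [Finset.coe_filter, Set.mem_ofPred_eq, Finset.mem_Icc] at hs ht
    simp only [Prod.mk.injEq] at hst
    rcases lt_trichotomy s t with h | h | h
    · exact absurd (pullCount_lt_of_lt hs.1.1 h hst.1 hs.2.1) (by omega)
    · exact h
    · exact absurd (pullCount_lt_of_lt ht.1.1 h hst.1.symm ht.2.1) (by omega)

/-- The term n = 0 is 0 by the convention for inverses, so this is a harmonic sum. -/
lemma sum_range_inv_le (T : ℕ) :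
    ∑ n ∈ Finset.range T, ((n : ℝ))⁻¹ ≤ 1 + Real.log T := by
  rcases T with _ | T
  · simp
  rw [Finset.sum_range_succ']
  have h := harmonic_le_one_add_log T
  simp only [harmonic, Rat.cast_sum, Rat.cast_inv, Rat.cast_natCast] at h
  have h2 : Real.log T ≤ Real.log (T + 1 : ℕ) := by
    rcases T.eq_zero_or_pos with rfl | hT
    · simp
    · exact Real.log_le_log (by exact_mod_cast hT) (by exact_mod_cast Nat.le_succ T)
  simp only [Nat.cast_zero, inv_zero, add_zero]
  linarith

/-- Sum over all rounds of the inverse time since the last restart. -/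
lemma sum_inv_mod_le {H T : ℕ} (hH : 0 < H) (hHT : H ≤ T) :
    ∑ t ∈ Finset.Icc 1 T, (((t - 1) % H : ℕ) : ℝ)⁻¹ ≤ ((T / H : ℕ) + 1 : ℝ) * (1 + Real.log T) := by
  -- Quotient and remainder determine the round, so the sum is dominated by one harmonic sum per
  -- interval.
  have hinj : Set.InjOn (fun t : ℕ => ((t - 1) / H, (t - 1) % H)) (Finset.Icc 1 T) := by
    intro s hs t ht hst
    simp only [Finset.coe_Icc, Set.mem_Icc] at hs ht
    simp only [Prod.mk.injEq] at hst
    have h1 := Nat.div_add_mod' (s - 1) H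
    have h2 := Nat.div_add_mod' (t - 1) H
    rw [hst.1, hst.2] at h1
    omega
  have h1 := Finset.sum_image (f := fun p : ℕ × ℕ => ((p.2 : ℕ) : ℝ)⁻¹) hinj
  simp only at h1
  rw [← h1]
  calc _ ≤ ∑ p ∈ Finset.range (T / H + 1) ×ˢ Finset.range T, ((p.2 : ℕ) : ℝ)⁻¹ := by
        refine Finset.sum_le_sum_of_subset_of_nonneg ?_ fun _ _ _ => by positivity
        intro p hp
        obtain ⟨t, ht, rfl⟩ := Finset.mem_image.1 hp
        rw [Finset.mem_Icc] at ht
        have : (t - 1) / H ≤ T / H := Nat.div_le_div_right (by omega)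
        have := Nat.mod_lt (t - 1) hH
        simp only [Finset.mem_product, Finset.mem_range]
        omega
    _ = ((T / H : ℕ) + 1 : ℝ) * ∑ n ∈ Finset.range T, ((n : ℝ))⁻¹ := by
        rw [Finset.sum_product]; simp
    _ ≤ _ := by gcongr; exact sum_range_inv_le T

/-- The mean rewards have not changed since the last restart. -/
def IsFresh (H : ℕ) (μ : ℕ → Fin N → Fin K → ℝ) (t : ℕ) : Prop :=
  ∀ s ∈ Finset.Icc (lastRestart H t) t, μ s = μ t

open Classical in
lemma card_change_rounds_le (μ : ℕ → Fin N → Fin K → ℝ) (T : ℕ) :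
    ((Finset.Icc 2 T).filter fun s => μ s ≠ μ (s - 1)).card ≤ numChanges μ T := by
  rw [Finset.card_filter, numChanges]
  refine Finset.sum_le_sum fun t _ => ?_
  split_ifs with h
  · obtain ⟨i, hi⟩ := Function.ne_iff.1 h
    obtain ⟨j, hj⟩ := Function.ne_iff.1 hi
    calc 1 = if μ t i j ≠ μ (t - 1) i j then 1 else 0 := by rw [if_pos hj]
      _ ≤ ∑ j, if μ t i j ≠ μ (t - 1) i j then 1 else 0 :=
        Finset.single_le_sum (f := fun j => if μ t i j ≠ μ (t - 1) i j then 1 else 0)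
          (fun _ _ => Nat.zero_le _) (Finset.mem_univ j)
      _ ≤ _ :=
        Finset.single_le_sum (f := fun i => ∑ j, if μ t i j ≠ μ (t - 1) i j then 1 else 0)
          (fun _ _ => Nat.zero_le _) (Finset.mem_univ i)
  · exact Nat.zero_le _

-- Intervals have length H, so a change at round s can spoil only the rounds s, …, s + H - 1.
open Classical in
lemma card_not_isFresh_le {H : ℕ} (hH : 0 < H) (μ : ℕ → Fin N → Fin K → ℝ) (T : ℕ) :
    ((Finset.Icc 1 T).filter fun t => ¬ IsFresh H μ t).card ≤ numChanges μ T * H := by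
  set c := (Finset.Icc 2 T).filter fun s => μ s ≠ μ (s - 1)
  have hsub : ((Finset.Icc 1 T).filter fun t => ¬ IsFresh H μ t) ⊆
      c.biUnion fun s => Finset.Ico s (s + H) := by
    intro t ht
    rw [Finset.mem_filter, Finset.mem_Icc] at ht
    obtain ⟨⟨h1, hT⟩, hf⟩ := ht
    by_contra hc
    apply hf
    -- Walk back from t to the restart: a change met on the way would put t in the window of that
    -- change, against `hc`.
    have key : ∀ d : ℕ, d ≤ t - lastRestart H t → μ (t - d) = μ t := by
      intro d
      induction d with
      | zero => simp
      | succ d ih =>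
        intro hd
        rw [← ih (by omega)]
        by_contra hne
        apply hc
        have := lt_lastRestart_add (t := t) hH
        have := one_le_lastRestart H t
        have h3 : t - (d + 1) = t - d - 1 := by omega
        refine Finset.mem_biUnion.2 ⟨t - d, ?_, ?_⟩
        · rw [Finset.mem_filter, Finset.mem_Icc]
          exact ⟨by omega, fun h => hne (by rw [h3, ← h])⟩
        · rw [Finset.mem_Ico]; omega
    intro s hs
    rw [Finset.mem_Icc] at hs
    have := key (t - s) (by omega)
    rwa [Nat.sub_sub_self hs.2] at this
  calc _ ≤ _ := Finset.card_le_card hsub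
    _ ≤ c.card * H := Finset.card_biUnion_le_card_mul _ _ _ fun s _ => by simp
    _ ≤ _ := Nat.mul_le_mul_right _ (card_change_rounds_le μ T)

/-- This makes L at most N·K·√(LT), which absorbs the cost of rounding H up. -/
lemma numChanges_le (μ : ℕ → Fin N → Fin K → ℝ) (T : ℕ) : numChanges μ T ≤ N * K * T := by
  unfold numChanges
  calc _ ≤ ∑ t ∈ Finset.Icc 2 T, ∑ _i : Fin N, ∑ _j : Fin K, 1 := by
        gcongr; split_ifs <;> simp
    _ ≤ N * K * T := by
        simp only [Finset.sum_const, Finset.card_univ, Fintype.card_fin, smul_eq_mul, mul_one,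
          Nat.card_Icc]
        rw [mul_comm]
        exact Nat.mul_le_mul_left _ (by omega)

end Combinatorics

/-- A geometric series without its term n = 0, bounded using 1 + x ≤ exp x. It pays for the union
over the possible numbers of observations and produces the factor 1/Δ². -/
lemma sum_exp_neg_mul_le {x : ℝ} (hx : 0 < x) (s : Finset ℕ) (hs : ∀ n ∈ s, 1 ≤ n) :
    ∑ n ∈ s, Real.exp (-(n * x)) ≤ 1 / x := by
  have hlt : Real.exp (-x) < 1 := by rw [Real.exp_lt_one_iff]; linarith
  have hsum := (hasSum_geometric_of_lt_one (Real.exp_pos (-x)).le hlt)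
  have hterm : ∀ n : ℕ, Real.exp (-(n * x)) = Real.exp (-x) ^ n := fun n => by
    rw [← Real.exp_nat_mul]; ring_nf
  have h1 : ∑ n ∈ insert 0 s, Real.exp (-x) ^ n ≤ (1 - Real.exp (-x))⁻¹ :=
    sum_le_hasSum _ (fun _ _ => by positivity) hsum
  have h0 : (0 : ℕ) ∉ s := fun h => by simpa using hs 0 h
  rw [Finset.sum_insert h0, pow_zero] at h1
  simp only [hterm]
  have hpos : 0 < 1 - Real.exp (-x) := by linarith
  have h2 : Real.exp (-x) * (1 + x) ≤ 1 := by
    calc _ ≤ Real.exp (-x) * Real.exp x := by gcongr; linarith [Real.add_one_le_exp x]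
      _ = 1 := by rw [← Real.exp_add]; simp
  have h3 : (1 - Real.exp (-x))⁻¹ ≤ 1 + 1 / x := by
    rw [inv_le_comm₀ hpos (by positivity)]
    have : (1 + 1 / x)⁻¹ = x / (1 + x) := by field_simp; ring
    rw [this, div_le_iff₀ (by positivity)]
    nlinarith
  linarith

end RCB

namespace RCB

/-! ### The exponential supermartingale of the rewards from one arm. -/

section Supermartingale

variable {N K : ℕ} {Ω : Type*} [mΩ : MeasurableSpace Ω] {P : Measure Ω} [IsProbabilityMeasure P]
  {ℱ : Filtration ℕ mΩ} {T : ℕ} {σ : ℝ} {μ : ℕ → Fin N → Fin K → ℝ}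
  {m : ℕ → Ω → Matching N K} {X : ℕ → Fin N → Ω → ℝ}

/-- The rewards of player `i` from arm `k` in the rounds `a, …, t - 1`, centred. -/
noncomputable def noise (μ : ℕ → Fin N → Fin K → ℝ) (m : ℕ → Ω → Matching N K)
    (X : ℕ → Fin N → Ω → ℝ) (i : Fin N) (k : Fin K) (a t : ℕ) (ω : Ω) : ℝ :=
  ∑ s ∈ (Finset.Ico a t).filter (fun s => m s ω i = k), (X s i ω - μ s i (m s ω i))

/-- The exponential supermartingale of the centred rewards of player `i` from arm `k`. -/
noncomputable def expMart (v : ℝ) (μ : ℕ → Fin N → Fin K → ℝ) (m : ℕ → Ω → Matching N K)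
    (X : ℕ → Fin N → Ω → ℝ) (i : Fin N) (k : Fin K) (a t : ℕ) (l : ℝ) (ω : Ω) : ℝ :=
  Real.exp (l * noise μ m X i k a t ω -
    ((Finset.Ico a t).filter (fun s => m s ω i = k)).card * (v * l ^ 2 / 2))

omit mΩ in
lemma noise_succ {i : Fin N} {k : Fin K} {a t : ℕ} (hat : a ≤ t) (ω : Ω) :
    noise μ m X i k a (t + 1) ω =
      noise μ m X i k a t ω + if m t ω i = k then X t i ω - μ t i (m t ω i) else 0 := by
  simp only [noise, Finset.sum_filter, Finset.sum_Ico_succ_top hat]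

omit mΩ in
lemma expMart_succ {v : ℝ} {i : Fin N} {k : Fin K} {a t : ℕ} (hat : a ≤ t) (l : ℝ) (ω : Ω) :
    expMart v μ m X i k a (t + 1) l ω = expMart v μ m X i k a t l ω *
      if m t ω i = k then
        Real.exp (l * (X t i ω - μ t i (m t ω i))) * Real.exp (-(v * l ^ 2 / 2)) else 1 := by
  simp only [expMart, noise_succ hat, Finset.card_filter, Finset.sum_Ico_succ_top hat]
  split_ifs with h
  · rw [← Real.exp_add, ← Real.exp_add]
    congr 1
    push_cast
    ring
  · simp

omit [IsProbabilityMeasure P] in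
lemma IsRewardProcess.measurable_diff (h : IsRewardProcess P ℱ T σ μ m X) {t : ℕ}
    (ht : t ∈ Finset.Icc 1 T) (i : Fin N) :
    Measurable[ℱ (t + 1)] (fun ω => X t i ω - μ t i (m t ω i)) :=
  (h.reward_measurable t ht i).sub
    ((measurable_of_finite (μ t i)).comp
      ((h.matching_measurable t ht i).mono (ℱ.mono (Nat.le_succ t)) le_rfl))

omit [IsProbabilityMeasure P] in
lemma IsRewardProcess.measurableSet_pull (h : IsRewardProcess P ℱ T σ μ m X) {t : ℕ}
    (ht : t ∈ Finset.Icc 1 T) (i : Fin N) (k : Fin K) :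
    MeasurableSet[ℱ t] {ω | m t ω i = k} :=
  h.matching_measurable t ht i (measurableSet_singleton k)

omit [IsProbabilityMeasure P] in
lemma IsRewardProcess.measurable_noise (h : IsRewardProcess P ℱ T σ μ m X) {i : Fin N}
    {k : Fin K} {a t : ℕ} (ha : 1 ≤ a) (hat : a ≤ t) (ht : t ≤ T + 1) :
    Measurable[ℱ t] (noise μ m X i k a t) := by
  induction t, hat using Nat.le_induction with
  | base =>
    have : noise μ m X i k a a = fun _ => 0 := by ext; simp [noise]
    rw [this]; exact measurable_const
  | succ t hat ih =>
    have hmem : t ∈ Finset.Icc 1 T := Finset.mem_Icc.2 ⟨by omega, by omega⟩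
    have : noise μ m X i k a (t + 1) = fun ω =>
      noise μ m X i k a t ω + if m t ω i = k then X t i ω - μ t i (m t ω i) else 0 :=
      funext fun ω => noise_succ hat ω
    rw [this]
    refine Measurable.add ((ih (by omega)).mono (ℱ.mono (Nat.le_succ t)) le_rfl) ?_
    exact Measurable.ite (ℱ.mono (Nat.le_succ t) _ (h.measurableSet_pull hmem i k))
      (h.measurable_diff hmem i) measurable_const

omit [IsProbabilityMeasure P] in
lemma IsRewardProcess.measurable_expMart (h : IsRewardProcess P ℱ T σ μ m X) {v : ℝ} {i : Fin N}
    {k : Fin K} {a t : ℕ} (ha : 1 ≤ a) (hat : a ≤ t) (ht : t ≤ T + 1) (l : ℝ) :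
    Measurable[ℱ t] (expMart v μ m X i k a t l) := by
  refine Real.measurable_exp.comp (Measurable.sub ((h.measurable_noise ha hat ht).const_mul l)
    (Measurable.mul_const ?_ _))
  simp only [Finset.card_filter, Nat.cast_sum]
  refine Finset.measurable_sum _ fun s hs => ?_
  rw [Finset.mem_Ico] at hs
  have hmem : s ∈ Finset.Icc 1 T := Finset.mem_Icc.2 ⟨by omega, by omega⟩
  have : (fun ω => ((if m s ω i = k then 1 else 0 : ℕ) : ℝ)) =
      fun ω => if m s ω i = k then (1 : ℝ) else 0 := by ext; split_ifs <;> simp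
  rw [this]
  exact Measurable.ite (ℱ.mono hs.2.le _ (h.measurableSet_pull hmem i k))
    measurable_const measurable_const

/-- The bound exp(l(x + y)) ≤ exp(2lx) + exp(2ly) avoids any independence argument. It doubles the
parameter, so the induction has to carry all l at once. -/
lemma IsRewardProcess.integrable_exp_noise (h : IsRewardProcess P ℱ T σ μ m X) {i : Fin N}
    {k : Fin K} {a t : ℕ} (ha : 1 ≤ a) (hat : a ≤ t) (ht : t ≤ T + 1) :
    ∀ l : ℝ, Integrable (fun ω => Real.exp (l * noise μ m X i k a t ω)) P := by
  induction t, hat using Nat.le_induction with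
  | base => intro l; simp [noise]
  | succ t hat ih =>
    intro l
    have hmem : t ∈ Finset.Icc 1 T := Finset.mem_Icc.2 ⟨by omega, by omega⟩
    have hm : Measurable (fun ω => Real.exp (l * noise μ m X i k a (t + 1) ω)) :=
      Real.measurable_exp.comp (((h.measurable_noise ha (by omega) ht).mono
        (ℱ.le _) le_rfl).const_mul l)
    refine Integrable.mono' (((ih (by omega) (2 * l)).add
      ((h.exp_integrable t hmem i (2 * l)).add (integrable_const 1)))) hm.aestronglyMeasurable
      (ae_of_all _ fun ω => ?_)
    rw [Real.norm_eq_abs, abs_of_pos (Real.exp_pos _), noise_succ hat]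
    set A := noise μ m X i k a t ω
    set B := X t i ω - μ t i (m t ω i)
    have key : ∀ x y : ℝ, Real.exp (l * (x + y)) ≤ Real.exp (2 * l * x) + Real.exp (2 * l * y) := by
      intro x y
      have hx : Real.exp (2 * l * x) = Real.exp (l * x) ^ 2 := by
        rw [← Real.exp_nat_mul]; push_cast; ring_nf
      have hy : Real.exp (2 * l * y) = Real.exp (l * y) ^ 2 := by
        rw [← Real.exp_nat_mul]; push_cast; ring_nf
      rw [mul_add, Real.exp_add, hx, hy]
      nlinarith [sq_nonneg (Real.exp (l * x) - Real.exp (l * y)), sq_nonneg (Real.exp (l * x)),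
        sq_nonneg (Real.exp (l * y))]
    simp only [Pi.add_apply]
    split_ifs
    · linarith [key A B]
    · have := key A 0
      simp only [mul_zero, Real.exp_zero] at this
      linarith [Real.exp_pos (2 * l * B)]

lemma IsRewardProcess.integrable_expMart (h : IsRewardProcess P ℱ T σ μ m X) {v : ℝ} (hv : 0 ≤ v)
    {i : Fin N} {k : Fin K} {a t : ℕ} (ha : 1 ≤ a) (hat : a ≤ t) (ht : t ≤ T + 1) (l : ℝ) :
    Integrable (expMart v μ m X i k a t l) P := by
  refine Integrable.mono' (h.integrable_exp_noise ha hat ht (i := i) (k := k) l)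
    ((h.measurable_expMart ha hat ht l).mono (ℱ.le _) le_rfl).aestronglyMeasurable
    (ae_of_all _ fun ω => ?_)
  rw [Real.norm_eq_abs, expMart, abs_of_pos (Real.exp_pos _), Real.exp_le_exp]
  have : 0 ≤ (((Finset.Ico a t).filter (fun s => m s ω i = k)).card : ℝ) * (v * l ^ 2 / 2) := by
    positivity
  linarith

/-- Whether the arm is pulled in round t is known given `ℱ t`. On a pull the new factor has
conditional mean at most 1 because v ≥ σ²; otherwise it equals 1. -/
lemma IsRewardProcess.integral_expMart_le_one (h : IsRewardProcess P ℱ T σ μ m X) {v : ℝ}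
    (hv : σ ^ 2 ≤ v) {i : Fin N} {k : Fin K} {a t : ℕ} (ha : 1 ≤ a) (hat : a ≤ t)
    (ht : t ≤ T + 1) (l : ℝ) :
    ∫ ω, expMart v μ m X i k a t l ω ∂P ≤ 1 := by
  have hv0 : 0 ≤ v := (sq_nonneg σ).trans hv
  induction t, hat using Nat.le_induction with
  | base => simp [expMart, noise]
  | succ t hat ih =>
    have hmem : t ∈ Finset.Icc 1 T := Finset.mem_Icc.2 ⟨by omega, by omega⟩
    refine le_trans ?_ (ih (by omega))
    set M := expMart v μ m X i k a t l with hM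
    set E := {ω | m t ω i = k} with hE
    set W := fun ω => Real.exp (l * (X t i ω - μ t i (m t ω i))) with hW
    set c := Real.exp (-(v * l ^ 2 / 2)) with hc
    have hEm : MeasurableSet[ℱ t] E := h.measurableSet_pull hmem i k
    have hEm' : MeasurableSet E := ℱ.le t _ hEm
    have hMm : Measurable[ℱ t] M := h.measurable_expMart ha hat (by omega) l
    have hMi : Integrable M P := h.integrable_expMart hv0 ha hat (by omega) l
    have hSi := h.integrable_expMart hv0 (i := i) (k := k) ha (hat.trans (Nat.le_succ t)) ht l
    have hG : StronglyMeasurable[ℱ t] (E.indicator M) :=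
      (hMm.stronglyMeasurable).indicator hEm
    have hMpos : ∀ ω, 0 ≤ M ω := fun ω => (Real.exp_pos _).le
    have hGpos : ∀ ω, 0 ≤ E.indicator M ω := fun ω => Set.indicator_nonneg (fun ω _ => hMpos ω) ω
    have hsucc : expMart v μ m X i k a (t + 1) l =
        fun ω => c * (E.indicator M ω * W ω) + Eᶜ.indicator M ω := by
      ext ω
      rw [expMart_succ hat]
      by_cases hω : m t ω i = k
      · have h1 : ω ∈ E := hω
        have h2 : ω ∉ Eᶜ := fun h => h h1
        rw [if_pos hω, Set.indicator_of_mem h1, Set.indicator_of_notMem h2]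
        ring
      · have h1 : ω ∉ E := hω
        rw [if_neg hω, Set.indicator_of_notMem h1, Set.indicator_of_mem (show ω ∈ Eᶜ from h1)]
        ring
    have hcpos : 0 < c := Real.exp_pos _
    -- A product of integrable functions need not be integrable; here, on `E`, it is a multiple of
    -- the integrable process at t + 1.
    have hGW : Integrable (E.indicator M * W) P := by
      have : E.indicator M * W = fun ω =>
          c⁻¹ * E.indicator (expMart v μ m X i k a (t + 1) l) ω := by
        ext ω
        by_cases h1 : ω ∈ E
        · have h2 : ω ∉ Eᶜ := fun h => h h1
          simp only [Pi.mul_apply, hsucc, Set.indicator_of_mem h1, Set.indicator_of_notMem h2]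
          field_simp
          ring
        · simp [Set.indicator_of_notMem h1]
      rw [this]
      exact (hSi.indicator hEm').const_mul _
    have hcond : P[E.indicator M * W | ℱ t] =ᵐ[P] E.indicator M * P[W | ℱ t] :=
      condExp_mul_of_stronglyMeasurable_left hG hGW (h.exp_integrable t hmem i l)
    have hle : ∫ ω, E.indicator M ω * W ω ∂P ≤ ∫ ω, c⁻¹ * E.indicator M ω ∂P := by
      have h1 : ∫ ω, E.indicator M ω * W ω ∂P = ∫ ω, P[E.indicator M * W | ℱ t] ω ∂P :=
        (integral_condExp (ℱ.le t)).symm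
      rw [h1]
      refine integral_mono_ae integrable_condExp ((hMi.indicator hEm').const_mul _) ?_
      filter_upwards [hcond, h.subGaussian t hmem i l] with ω h2 h3
      rw [h2, Pi.mul_apply, mul_comm]
      refine mul_le_mul_of_nonneg_right (h3.trans ?_) (hGpos ω)
      rw [hc, ← Real.exp_neg, neg_neg, Real.exp_le_exp]
      have := mul_le_mul_of_nonneg_right hv (sq_nonneg l)
      linarith
    rw [integral_const_mul] at hle
    have h6 : ∫ ω, expMart v μ m X i k a (t + 1) l ω ∂P =
        c * ∫ ω, E.indicator M ω * W ω ∂P + ∫ ω, Eᶜ.indicator M ω ∂P := by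
      rw [hsucc, ← integral_const_mul]
      exact integral_add (hGW.const_mul c) (hMi.indicator hEm'.compl)
    rw [h6]
    have h4 : ∫ ω, M ω ∂P = ∫ ω, E.indicator M ω ∂P + ∫ ω, Eᶜ.indicator M ω ∂P := by
      rw [integral_indicator hEm', integral_indicator hEm'.compl, integral_add_compl hEm' hMi]
    rw [h4]
    have h5 : c * ∫ ω, E.indicator M ω * W ω ∂P ≤ ∫ ω, E.indicator M ω ∂P := by
      calc _ ≤ c * (c⁻¹ * ∫ ω, E.indicator M ω ∂P) := by gcongr
        _ = _ := by field_simp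
    linarith

omit mΩ in
/-- The Chernoff bound, pathwise: a deviation of at least `e` of the empirical mean of `n` rewards
makes the supermartingale large. -/
lemma one_le_exp_mul_expMart {v : ℝ} (hv : 0 < v) {i : Fin N} {k : Fin K} {a t : ℕ} {ω : Ω} {e : ℝ}
    (h : ((Finset.Ico a t).filter (fun s => m s ω i = k)).card * e ^ 2 ≤
      e * noise μ m X i k a t ω) :
    1 ≤ Real.exp (-(((Finset.Ico a t).filter (fun s => m s ω i = k)).card * (e ^ 2 / (2 * v)))) *
      expMart v μ m X i k a t (e / v) ω := by
  rw [expMart, ← Real.exp_add, Real.one_le_exp_iff]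
  set n : ℝ := (((Finset.Ico a t).filter (fun s => m s ω i = k)).card : ℝ)
  set z := noise μ m X i k a t ω
  -- The parameter e / v is the Chernoff optimum. The sign of e is free, so both tails are covered.
  have : -(n * (e ^ 2 / (2 * v))) + (e / v * z - n * (v * (e / v) ^ 2 / 2)) =
      (e * z - n * e ^ 2) / v := by field_simp; ring
  rw [this]
  exact div_nonneg (by linarith) hv.le

end Supermartingale

end RCB

namespace RCB

/-! ### Failures of the confidence bounds and their expected number. -/

section Deviations

variable {N K : ℕ} {Ω : Type*}

/-- Dominates the indicator of the event that the upper confidence bound of arm `k` falls short of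
the mean reward by more than `Δ / 2`. -/
noncomputable def lowerDev (T : ℕ) (α Δ : ℝ) (H : ℕ) (μ : ℕ → Fin N → Fin K → ℝ)
    (m : ℕ → Ω → Matching N K) (X : ℕ → Fin N → Ω → ℝ) (i : Fin N) (k : Fin K) (t : ℕ) (ω : Ω) :
    ℝ :=
  ∑ n ∈ Finset.Icc 1 T, Real.exp (-(n * (Δ ^ 2 / (4 * α)))) * ((t - lastRestart H t : ℕ) : ℝ)⁻¹ *
    expMart (α / 2) μ m X i k (lastRestart H t) t
      (-(Δ / 2 + √(α * Real.log ((t - lastRestart H t : ℕ) : ℝ) / n)) / (α / 2)) ω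

/-- The number of observations after which the confidence width is at most `Δ / 4`. -/
noncomputable def sampleThreshold (T : ℕ) (α Δ : ℝ) : ℝ := 32 * α * Real.log T / Δ ^ 2

/-- Dominates the indicator of the event that the empirical mean of the well explored arm `k`
exceeds the mean reward by at least `Δ / 4`. -/
noncomputable def upperDev (T : ℕ) (α Δ : ℝ) (H : ℕ) (μ : ℕ → Fin N → Fin K → ℝ)
    (m : ℕ → Ω → Matching N K) (X : ℕ → Fin N → Ω → ℝ) (i : Fin N) (k : Fin K) (t : ℕ) (ω : Ω) :
    ℝ :=
  ∑ n ∈ (Finset.Icc 1 T).filter (fun n : ℕ => sampleThreshold T α Δ < n),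
    Real.exp (-(n * (Δ ^ 2 / (16 * α)))) *
      expMart (α / 2) μ m X i k (lastRestart H t) t (Δ / 4 / (α / 2)) ω

variable {T H : ℕ} {α Δ : ℝ} {μ : ℕ → Fin N → Fin K → ℝ} {m : ℕ → Ω → Matching N K}
  {X : ℕ → Fin N → Ω → ℝ} {i : Fin N} {k : Fin K} {t : ℕ} {ω : Ω}

lemma expMart_pos {v : ℝ} {a : ℕ} {l : ℝ} : 0 < expMart v μ m X i k a t l ω := Real.exp_pos _

lemma lowerDev_nonneg : 0 ≤ lowerDev T α Δ H μ m X i k t ω :=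
  Finset.sum_nonneg fun _ _ => mul_nonneg (by positivity) expMart_pos.le

lemma upperDev_nonneg : 0 ≤ upperDev T α Δ H μ m X i k t ω :=
  Finset.sum_nonneg fun _ _ => mul_nonneg (by positivity) expMart_pos.le

/-- While the means are unchanged, the centred rewards are the error of the empirical mean. -/
lemma IsFresh.noise_eq (hf : IsFresh H μ t)
    (hn : pullCount H (fun s => m s ω) i k t ≠ 0) :
    noise μ m X i k (lastRestart H t) t ω = pullCount H (fun s => m s ω) i k t *
      (empiricalMean H (fun s => m s ω) (fun s i => X s i ω) i k t - μ t i k) := by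
  have h1 : noise μ m X i k (lastRestart H t) t ω =
      ∑ s ∈ pullRounds H (fun s => m s ω) i k t, (X s i ω - μ t i k) := by
    refine Finset.sum_congr rfl fun s hs => ?_
    rw [pullRounds, Finset.mem_filter, Finset.mem_Ico] at hs
    rw [hs.2, hf s (Finset.mem_Icc.2 ⟨hs.1.1, hs.1.2.le⟩)]
  rw [h1, Finset.sum_sub_distrib, Finset.sum_const, nsmul_eq_mul, mul_sub, empiricalMean]
  have : (pullCount H (fun s => m s ω) i k t : ℝ) ≠ 0 := by exact_mod_cast hn
  rw [mul_div_cancel₀ _ this]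
  rfl

lemma one_le_lowerDev (hα : 0 < α) (hΔ : 0 < Δ) (ht : t ∈ Finset.Icc 1 T) (hf : IsFresh H μ t)
    (hn : pullCount H (fun s => m s ω) i k t ≠ 0)
    (hu : empiricalMean H (fun s => m s ω) (fun s i => X s i ω) i k t +
      √(α * Real.log ((t - lastRestart H t : ℕ) : ℝ) / pullCount H (fun s => m s ω) i k t)
        ≤ μ t i k - Δ / 2) :
    1 ≤ lowerDev T α Δ H μ m X i k t ω := by
  rw [Finset.mem_Icc] at ht
  set n := pullCount H (fun s => m s ω) i k t with hndef
  set τ := t - lastRestart H t with hτ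
  have hnτ : n ≤ τ := by
    rw [hτ, sub_lastRestart]; exact pullCount_le _ _ _ _ _
  have hnpos : 0 < n := Nat.pos_of_ne_zero hn
  -- At a restart τ = 0 and its inverse is 0 by convention; a positive count excludes this case.
  have hτpos : (0 : ℝ) < τ := by exact_mod_cast hnpos.trans_le hnτ
  have hnpos' : (0 : ℝ) < n := by exact_mod_cast hnpos
  have hlog : 0 ≤ Real.log τ := Real.log_natCast_nonneg τ
  have hmem : n ∈ Finset.Icc 1 T := Finset.mem_Icc.2 ⟨hnpos, by omega⟩
  -- Only the summand at the realised count is needed; the others are nonnegative.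
  refine le_trans ?_ (Finset.single_le_sum (f := fun n : ℕ =>
    Real.exp (-(n * (Δ ^ 2 / (4 * α)))) * ((t - lastRestart H t : ℕ) : ℝ)⁻¹ *
    expMart (α / 2) μ m X i k (lastRestart H t) t
      (-(Δ / 2 + √(α * Real.log ((t - lastRestart H t : ℕ) : ℝ) / n)) / (α / 2)) ω)
    (fun _ _ => mul_nonneg (by positivity) expMart_pos.le) hmem)
  rw [← hτ]
  set b := √(α * Real.log (τ : ℝ) / n) with hb
  have hbsq : b ^ 2 = α * Real.log τ / n := Real.sq_sqrt (by positivity)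
  have hb0 : 0 ≤ b := Real.sqrt_nonneg _
  have hz := hf.noise_eq (X := X) (hndef ▸ hn)
  rw [← hndef] at hz
  set y := empiricalMean H (fun s => m s ω) (fun s i => X s i ω) i k t
  have hmain := one_le_exp_mul_expMart (μ := μ) (m := m) (X := X) (i := i) (k := k)
    (a := lastRestart H t) (t := t) (ω := ω) (v := α / 2) (e := -(Δ / 2 + b)) (by positivity) (by
      change (n : ℝ) * _ ≤ _
      rw [hz]
      have : 0 ≤ n * ((Δ / 2 + b) * (μ t i k - Δ / 2 - b - y)) :=
        mul_nonneg hnpos'.le (mul_nonneg (by positivity) (by linarith))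
      nlinarith)
  refine hmain.trans (mul_le_mul_of_nonneg_right ?_ expMart_pos.le)
  change Real.exp (-((n : ℝ) * _)) ≤ _
  have hinv : (τ : ℝ)⁻¹ = Real.exp (-Real.log τ) := by rw [Real.exp_neg, Real.exp_log hτpos]
  rw [hinv, ← Real.exp_add, Real.exp_le_exp]
  -- With v = α / 2 the square of Δ / 2 + b splits: Δ² / 4 gives the geometric decay, b² gives
  -- exactly log τ, and the cross term is dropped.
  have h1 : (n : ℝ) * ((-(Δ / 2 + b)) ^ 2 / (2 * (α / 2))) =
      n * (Δ ^ 2 / (4 * α)) + n * b ^ 2 / α + n * Δ * b / α := by field_simp; ring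
  have h2 : n * b ^ 2 / α = Real.log τ := by rw [hbsq]; field_simp
  have h3 : 0 ≤ n * Δ * b / α := by positivity
  rw [h1, h2]
  linarith

lemma one_le_upperDev (hα : 0 < α) (hΔ : 0 < Δ) (ht : t ∈ Finset.Icc 1 T) (hf : IsFresh H μ t)
    (hn : sampleThreshold T α Δ < pullCount H (fun s => m s ω) i k t)
    (hu : μ t i k + Δ / 2 ≤ empiricalMean H (fun s => m s ω) (fun s i => X s i ω) i k t +
      √(α * Real.log ((t - lastRestart H t : ℕ) : ℝ) / pullCount H (fun s => m s ω) i k t)) :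
    1 ≤ upperDev T α Δ H μ m X i k t ω := by
  rw [Finset.mem_Icc] at ht
  set n := pullCount H (fun s => m s ω) i k t with hndef
  set τ := t - lastRestart H t with hτ
  have hnτ : n ≤ τ := by
    rw [hτ, sub_lastRestart]; exact pullCount_le _ _ _ _ _
  have hT0 : 0 ≤ Real.log T := Real.log_natCast_nonneg T
  have hnpos' : (0 : ℝ) < n := lt_of_le_of_lt (by unfold sampleThreshold; positivity) hn
  have hnpos : 0 < n := by exact_mod_cast hnpos'
  have hτpos : (0 : ℝ) < τ := by exact_mod_cast hnpos.trans_le hnτ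
  have hlog : Real.log τ ≤ Real.log T :=
    Real.log_le_log hτpos (by exact_mod_cast (show τ ≤ T by omega))
  have hmem : n ∈ (Finset.Icc 1 T).filter (fun n : ℕ => sampleThreshold T α Δ < n) :=
    Finset.mem_filter.2 ⟨Finset.mem_Icc.2 ⟨hnpos, by omega⟩, hn⟩
  have hwidth : √(α * Real.log (τ : ℝ) / n) ≤ Δ / 4 := by
    rw [Real.sqrt_le_left (by positivity), div_le_iff₀ hnpos']
    rw [sampleThreshold, div_lt_iff₀ (by positivity)] at hn
    nlinarith [mul_le_mul_of_nonneg_left hlog hα.le]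
  have hz := hf.noise_eq (X := X) (hndef ▸ hnpos.ne')
  rw [← hndef] at hz
  set y := empiricalMean H (fun s => m s ω) (fun s i => X s i ω) i k t
  have hmain := one_le_exp_mul_expMart (μ := μ) (m := m) (X := X) (i := i) (k := k)
    (a := lastRestart H t) (t := t) (ω := ω) (v := α / 2) (e := Δ / 4) (by positivity) (by
      change (n : ℝ) * _ ≤ _
      rw [hz]
      have : 0 ≤ n * (Δ / 4 * (y - μ t i k - Δ / 4)) :=
        mul_nonneg hnpos'.le (mul_nonneg (by positivity) (by linarith))
      nlinarith)
  refine le_trans ?_ (Finset.single_le_sum (f := fun n : ℕ =>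
    Real.exp (-(n * (Δ ^ 2 / (16 * α)))) *
      expMart (α / 2) μ m X i k (lastRestart H t) t (Δ / 4 / (α / 2)) ω)
    (fun _ _ => mul_nonneg (by positivity) expMart_pos.le) hmem)
  refine hmain.trans (le_of_eq ?_)
  change Real.exp (-((n : ℝ) * _)) * _ = _
  congr 4
  field_simp
  ring

/-- In a round in which the means have not changed since the last restart, positive regret has one
of three causes. -/
lemma exists_cause_of_lt_pessimal {π : Fin K → Fin N → ℝ}
    {r : ℕ → Ω → Fin N → Equiv.Perm (Fin K)} {b : Matching N K} (hα : 0 < α) (hΔ : 0 < Δ)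
    (hgap : ∀ t ∈ Finset.Icc 1 T, ∀ i k k', k ≠ k' → Δ ≤ |μ t i k - μ t i k'|)
    (hrun : IsRCBRun T α H π r m X) (ht : t ∈ Finset.Icc 1 T) (hf : IsFresh H μ t)
    (hb : IsPlayerPessimal π (μ t) b) (hlt : μ t i (m t ω i) < μ t i (b i)) :
    ∃ i' j, (m t ω i' = j ∧ pullCount H (fun s => m s ω) i' j t ≤ ⌊sampleThreshold T α Δ⌋₊) ∨
      1 ≤ lowerDev T α Δ H μ m X i' j t ω ∨ 1 ≤ upperDev T α Δ H μ m X i' j t ω := by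
  obtain ⟨i', k, hμ, hr⟩ := exists_misranked_of_lt_pessimal (hrun.stable t ht ω) hb hlt
  set j := m t ω i' with hj
  have hucb : ucb α H (fun s => m s ω) (fun s i => X s i ω) i' k t ≤
      ucb α H (fun s => m s ω) (fun s i => X s i ω) i' j t := by
    by_contra hc
    exact absurd (hrun.ranking t ht ω i' k j (not_le.1 hc)) (not_lt.2 hr)
  have hjk : μ t i' j ≤ μ t i' k - Δ := by
    have := hgap t ht i' j k (fun h => by rw [h] at hμ; exact lt_irrefl _ hμ)
    rw [abs_of_neg (by linarith)] at this
    linarith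
  by_cases hsmall : pullCount H (fun s => m s ω) i' j t ≤ ⌊sampleThreshold T α Δ⌋₊
  · exact ⟨i', j, Or.inl ⟨rfl, hsmall⟩⟩
  have hn : sampleThreshold T α Δ < pullCount H (fun s => m s ω) i' j t :=
    Nat.lt_of_floor_lt (not_le.1 hsmall)
  have hnj : pullCount H (fun s => m s ω) i' j t ≠ 0 := by omega
  -- An unobserved k would have an infinite index, above the finite one of j.
  have hnk : pullCount H (fun s => m s ω) i' k t ≠ 0 := by
    intro h0
    simp only [ucb, if_pos h0, if_neg hnj, top_le_iff] at hucb
    exact EReal.coe_ne_top _ hucb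
  simp only [ucb, if_neg hnk, if_neg hnj, EReal.coe_le_coe_iff] at hucb
  -- If the index of k exceeds its mean minus Δ / 2, then so does that of j, which by the gap is at
  -- least Δ / 2 above the mean of j.
  rcases le_or_gt (empiricalMean H (fun s => m s ω) (fun s i => X s i ω) i' k t +
      √(α * Real.log ((t - lastRestart H t : ℕ) : ℝ) / pullCount H (fun s => m s ω) i' k t))
        (μ t i' k - Δ / 2) with h | h
  · exact ⟨i', k, Or.inr (Or.inl (one_le_lowerDev hα hΔ ht hf hnk h))⟩
  · exact ⟨i', j, Or.inr (Or.inr (one_le_upperDev hα hΔ ht hf hn (by linarith)))⟩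

variable [mΩ : MeasurableSpace Ω] {P : Measure Ω} [IsProbabilityMeasure P]
  {ℱ : Filtration ℕ mΩ} {σ : ℝ}

lemma integrable_lowerDev (h : IsRewardProcess P ℱ T σ μ m X) (hα : 0 < α)
    (ht : t ∈ Finset.Icc 1 T) : Integrable (lowerDev T α Δ H μ m X i k t) P := by
  rw [Finset.mem_Icc] at ht
  exact integrable_finsetSum _ fun n _ => (h.integrable_expMart (by positivity)
    (one_le_lastRestart H t) (lastRestart_le ht.1) (by omega) _).const_mul _

lemma integrable_upperDev (h : IsRewardProcess P ℱ T σ μ m X) (hα : 0 < α)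
    (ht : t ∈ Finset.Icc 1 T) : Integrable (upperDev T α Δ H μ m X i k t) P := by
  rw [Finset.mem_Icc] at ht
  exact integrable_finsetSum _ fun n _ => (h.integrable_expMart (by positivity)
    (one_le_lastRestart H t) (lastRestart_le ht.1) (by omega) _).const_mul _

lemma integral_lowerDev_le (h : IsRewardProcess P ℱ T σ μ m X) (hα : 0 < α) (hΔ : 0 < Δ)
    (hσ : 2 * σ ^ 2 ≤ α) (ht : t ∈ Finset.Icc 1 T) :
    ∫ ω, lowerDev T α Δ H μ m X i k t ω ∂P ≤
      4 * α / Δ ^ 2 * (((t - 1) % H : ℕ) : ℝ)⁻¹ := by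
  rw [Finset.mem_Icc] at ht
  unfold lowerDev
  rw [integral_finsetSum _ fun n _ => (h.integrable_expMart (by positivity)
    (one_le_lastRestart H t) (lastRestart_le ht.1) (by omega) _).const_mul _]
  simp only [integral_const_mul, sub_lastRestart]
  calc _ ≤ ∑ n ∈ Finset.Icc 1 T, Real.exp (-(n * (Δ ^ 2 / (4 * α)))) *
          (((t - 1) % H : ℕ) : ℝ)⁻¹ := by
        refine Finset.sum_le_sum fun n _ => mul_le_of_le_one_right (by positivity) ?_
        exact h.integral_expMart_le_one (by linarith) (one_le_lastRestart H t)
          (lastRestart_le ht.1) (by omega) _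
    _ ≤ _ := by
        rw [← Finset.sum_mul]
        refine mul_le_mul_of_nonneg_right ?_ (by positivity)
        refine (sum_exp_neg_mul_le (by positivity) _ fun n hn => (Finset.mem_Icc.1 hn).1).trans
          (le_of_eq ?_)
        rw [one_div_div]

lemma integral_upperDev_le (h : IsRewardProcess P ℱ T σ μ m X) (hα : 0 < α) (hΔ : 0 < Δ)
    (hσ : 2 * σ ^ 2 ≤ α) (ht : t ∈ Finset.Icc 1 T) :
    ∫ ω, upperDev T α Δ H μ m X i k t ω ∂P ≤ 32 * α / Δ ^ 2 * (T : ℝ)⁻¹ := by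
  rw [Finset.mem_Icc] at ht
  have hT : (0 : ℝ) < T := by exact_mod_cast (show 0 < T by omega)
  unfold upperDev
  rw [integral_finsetSum _ fun n _ => (h.integrable_expMart (by positivity)
    (one_le_lastRestart H t) (lastRestart_le ht.1) (by omega) _).const_mul _]
  simp only [integral_const_mul]
  calc _ ≤ ∑ n ∈ (Finset.Icc 1 T).filter (fun n : ℕ => sampleThreshold T α Δ < n),
          Real.exp (-(n * (Δ ^ 2 / (32 * α)))) * (T : ℝ)⁻¹ := by
        refine Finset.sum_le_sum fun n hn => (mul_le_of_le_one_right (by positivity)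
          (h.integral_expMart_le_one (by linarith) (one_le_lastRestart H t)
            (lastRestart_le ht.1) (by omega) _)).trans ?_
        have hn := (Finset.mem_filter.1 hn).2
        rw [← Real.exp_log hT, ← Real.exp_neg, ← Real.exp_add, Real.exp_le_exp]
        rw [sampleThreshold, div_lt_iff₀ (by positivity)] at hn
        -- The threshold is twice what the width Δ / 4 requires. Half of the exponent then yields 1
        -- / T and the other half remains summable in n.
        have h1 : Real.log T ≤ n * (Δ ^ 2 / (32 * α)) := by
          rw [← mul_div_assoc, le_div_iff₀ (by positivity)]
          linarith
        have h2 : (n : ℝ) * (Δ ^ 2 / (16 * α)) = 2 * (n * (Δ ^ 2 / (32 * α))) := by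
          field_simp; ring
        linarith
    _ ≤ _ := by
        rw [← Finset.sum_mul]
        refine mul_le_mul_of_nonneg_right ?_ (by positivity)
        refine (sum_exp_neg_mul_le (by positivity) _ fun n hn =>
          (Finset.mem_Icc.1 (Finset.mem_filter.1 hn).1).1).trans (le_of_eq ?_)
        rw [one_div_div]

end Deviations

end RCB

namespace RCB

/-! ### From causes of regret to expected regret. -/

section Regret

variable {N K : ℕ} {Ω : Type*} {T H : ℕ} {α Δ μbar : ℝ} {μ : ℕ → Fin N → Fin K → ℝ}
  {m : ℕ → Ω → Matching N K} {X : ℕ → Fin N → Ω → ℝ} {π : Fin K → Fin N → ℝ}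
  {r : ℕ → Ω → Fin N → Equiv.Perm (Fin K)} {b : ℕ → Matching N K}

-- One round costs at most 2·μbar, and when it costs anything some nonnegative summand on the right
-- is at least 1.
open Classical in
lemma instant_regret_le (hα : 0 < α) (hΔ : 0 < Δ)
    (hbdd : ∀ t ∈ Finset.Icc 1 T, ∀ i k, |μ t i k| ≤ μbar)
    (hgap : ∀ t ∈ Finset.Icc 1 T, ∀ i k k', k ≠ k' → Δ ≤ |μ t i k - μ t i k'|)
    (hrun : IsRCBRun T α H π r m X) (hb : ∀ t ∈ Finset.Icc 1 T, IsPlayerPessimal π (μ t) (b t))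
    (i : Fin N) {t : ℕ} (ht : t ∈ Finset.Icc 1 T) (ω : Ω) :
    μ t i (b t i) - μ t i (m t ω i) ≤ 2 * μbar * ((if ¬ IsFresh H μ t then 1 else 0) +
      ∑ i', ∑ j, ((if m t ω i' = j ∧
          pullCount H (fun s => m s ω) i' j t ≤ ⌊sampleThreshold T α Δ⌋₊ then 1 else 0) +
        (lowerDev T α Δ H μ m X i' j t ω + upperDev T α Δ H μ m X i' j t ω))) := by
  have h1 := abs_le.1 (hbdd t ht i (b t i))
  have h2 := abs_le.1 (hbdd t ht i (m t ω i))
  have hμ0 : 0 ≤ μbar := (abs_nonneg _).trans (hbdd t ht i (b t i))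
  set f : Fin N → Fin K → ℝ := fun i' j => (if m t ω i' = j ∧
          pullCount H (fun s => m s ω) i' j t ≤ ⌊sampleThreshold T α Δ⌋₊ then 1 else 0) +
        (lowerDev T α Δ H μ m X i' j t ω + upperDev T α Δ H μ m X i' j t ω) with hf
  have hf0 : ∀ i' j, 0 ≤ f i' j := fun i' j =>
    add_nonneg (by split_ifs <;> simp) (add_nonneg lowerDev_nonneg upperDev_nonneg)
  have hS0 : 0 ≤ ∑ i', ∑ j, f i' j :=
    Finset.sum_nonneg fun i' _ => Finset.sum_nonneg fun j _ => hf0 i' j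
  have hI0 : (0 : ℝ) ≤ if ¬ IsFresh H μ t then 1 else 0 := by split_ifs <;> simp
  rcases le_or_gt (μ t i (b t i)) (μ t i (m t ω i)) with hle | hlt
  · have : 0 ≤ 2 * μbar * ((if ¬ IsFresh H μ t then 1 else 0) + ∑ i', ∑ j, f i' j) := by positivity
    linarith
  suffices hone : 1 ≤ (if ¬ IsFresh H μ t then (1 : ℝ) else 0) + ∑ i', ∑ j, f i' j by
    nlinarith
  by_cases hfr : IsFresh H μ t
  · obtain ⟨i', j, h⟩ := exists_cause_of_lt_pessimal hα hΔ hgap hrun ht hfr (hb t ht) hlt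
    have hfij : 1 ≤ f i' j := by
      simp only [hf]
      rcases h with h | h | h
      · rw [if_pos h]
        exact le_add_of_nonneg_right (add_nonneg lowerDev_nonneg upperDev_nonneg)
      · have := upperDev_nonneg (T := T) (α := α) (Δ := Δ) (H := H) (μ := μ) (m := m) (X := X)
          (i := i') (k := j) (t := t) (ω := ω)
        split_ifs <;> linarith
      · have := lowerDev_nonneg (T := T) (α := α) (Δ := Δ) (H := H) (μ := μ) (m := m) (X := X)
          (i := i') (k := j) (t := t) (ω := ω)
        split_ifs <;> linarith
    have h3 : f i' j ≤ ∑ j, f i' j :=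
      Finset.single_le_sum (f := fun j => f i' j) (fun j _ => hf0 i' j) (Finset.mem_univ j)
    have h4 : ∑ j, f i' j ≤ ∑ i', ∑ j, f i' j :=
      Finset.single_le_sum (f := fun i' => ∑ j, f i' j)
        (fun i' _ => Finset.sum_nonneg fun j _ => hf0 i' j) (Finset.mem_univ i')
    linarith
  · rw [if_pos hfr]; linarith

/-- The regret on a single sample path. -/
lemma pathwise_regret_le (hα : 0 < α) (hΔ : 0 < Δ) (hμ0 : 0 ≤ μbar) (hH : 0 < H)
    (hbdd : ∀ t ∈ Finset.Icc 1 T, ∀ i k, |μ t i k| ≤ μbar)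
    (hgap : ∀ t ∈ Finset.Icc 1 T, ∀ i k k', k ≠ k' → Δ ≤ |μ t i k - μ t i k'|)
    (hrun : IsRCBRun T α H π r m X) (hb : ∀ t ∈ Finset.Icc 1 T, IsPlayerPessimal π (μ t) (b t))
    (i : Fin N) (ω : Ω) :
    ∑ t ∈ Finset.Icc 1 T, μ t i (b t i) - ∑ t ∈ Finset.Icc 1 T, μ t i (m t ω i) ≤
      2 * μbar * (numChanges μ T * H +
        N * K * (((T / H : ℕ) + 1) * (sampleThreshold T α Δ + 1)) +
        ∑ t ∈ Finset.Icc 1 T, ∑ i', ∑ j,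
          (lowerDev T α Δ H μ m X i' j t ω + upperDev T α Δ H μ m X i' j t ω)) := by
  classical
  rw [← Finset.sum_sub_distrib]
  refine (Finset.sum_le_sum fun t ht =>
    instant_regret_le hα hΔ hbdd hgap hrun hb i ht ω).trans ?_
  rw [← Finset.mul_sum]
  refine mul_le_mul_of_nonneg_left ?_ (by positivity)
  simp only [Finset.sum_add_distrib, ← add_assoc]
  have h1 : ∑ t ∈ Finset.Icc 1 T, (if ¬ IsFresh H μ t then (1 : ℝ) else 0) ≤
      numChanges μ T * H := by
    rw [Finset.sum_boole]
    exact_mod_cast card_not_isFresh_le hH μ T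
  have hs0 : 0 ≤ sampleThreshold T α Δ := by
    have := Real.log_natCast_nonneg T
    unfold sampleThreshold; positivity
  have h2 : ∑ t ∈ Finset.Icc 1 T, ∑ i' : Fin N, ∑ j : Fin K, (if m t ω i' = j ∧
      pullCount H (fun s => m s ω) i' j t ≤ ⌊sampleThreshold T α Δ⌋₊ then (1 : ℝ) else 0) ≤
      N * K * (((T / H : ℕ) + 1) * (sampleThreshold T α Δ + 1)) := by
    rw [Finset.sum_comm]
    simp only [fun i' => Finset.sum_comm (s := Finset.Icc 1 T) (t := (Finset.univ : Finset (Fin K)))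
      (f := fun t j => if m t ω i' = j ∧ pullCount H (fun s => m s ω) i' j t ≤
        ⌊sampleThreshold T α Δ⌋₊ then (1 : ℝ) else 0)]
    calc _ ≤ ∑ _i : Fin N, ∑ _j : Fin K, (((T / H : ℕ) + 1 : ℝ) * (sampleThreshold T α Δ + 1)) := by
          refine Finset.sum_le_sum fun i' _ => Finset.sum_le_sum fun j _ => ?_
          rw [Finset.sum_boole]
          refine (Nat.cast_le.2 (card_pulls_of_small_count H T _ (fun s => m s ω) i' j)).trans ?_
          push_cast
          gcongr
          exact Nat.floor_le hs0
      _ = _ := by simp [mul_assoc]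
  linarith

variable [mΩ : MeasurableSpace Ω] {P : Measure Ω} [IsProbabilityMeasure P]
  {ℱ : Filtration ℕ mΩ} {σ : ℝ}

lemma agentRegret_le (hα : 0 < α) (hΔ : 0 < Δ) (hμ0 : 0 ≤ μbar) (hH : 0 < H) (hHT : H ≤ T)
    (hbdd : ∀ t ∈ Finset.Icc 1 T, ∀ i k, |μ t i k| ≤ μbar)
    (hgap : ∀ t ∈ Finset.Icc 1 T, ∀ i k k', k ≠ k' → Δ ≤ |μ t i k - μ t i k'|)
    (hσ : 2 * σ ^ 2 ≤ α) (hproc : IsRewardProcess P ℱ T σ μ m X)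
    (hrun : IsRCBRun T α H π r m X) (hb : ∀ t ∈ Finset.Icc 1 T, IsPlayerPessimal π (μ t) (b t))
    (i : Fin N) :
    agentRegret P μ b m T i ≤
      2 * μbar * (numChanges μ T * H +
        N * K * (((T / H : ℕ) + 1) * (sampleThreshold T α Δ + 1)) +
        N * K * (4 * α / Δ ^ 2 * (((T / H : ℕ) + 1) * (1 + Real.log T)) + 32 * α / Δ ^ 2)) := by
  have hT : (0 : ℝ) < T := by exact_mod_cast hH.trans_le hHT
  have hint : ∀ t ∈ Finset.Icc 1 T, Integrable (fun ω => μ t i (m t ω i)) P := fun t ht =>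
    Integrable.of_bound (((measurable_of_finite (μ t i)).comp
      ((hproc.matching_measurable t ht i).mono (ℱ.le t) le_rfl)).aestronglyMeasurable) μbar
      (ae_of_all _ fun ω => by rw [Real.norm_eq_abs]; exact hbdd t ht i _)
  have hdev : ∀ t ∈ Finset.Icc 1 T, ∀ i' j, Integrable (fun ω =>
      lowerDev T α Δ H μ m X i' j t ω + upperDev T α Δ H μ m X i' j t ω) P := fun t ht i' j =>
    (integrable_lowerDev hproc hα ht).add (integrable_upperDev hproc hα ht)
  have hdev1 : ∀ t ∈ Finset.Icc 1 T, ∀ i', Integrable (fun ω => ∑ j,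
      (lowerDev T α Δ H μ m X i' j t ω + upperDev T α Δ H μ m X i' j t ω)) P := fun t ht i' =>
    integrable_finsetSum _ fun j _ => hdev t ht i' j
  have hdev2 : ∀ t ∈ Finset.Icc 1 T, Integrable (fun ω => ∑ i', ∑ j,
      (lowerDev T α Δ H μ m X i' j t ω + upperDev T α Δ H μ m X i' j t ω)) P := fun t ht =>
    integrable_finsetSum _ fun i' _ => hdev1 t ht i'
  have hdev3 : Integrable (fun ω => ∑ t ∈ Finset.Icc 1 T, ∑ i', ∑ j,
      (lowerDev T α Δ H μ m X i' j t ω + upperDev T α Δ H μ m X i' j t ω)) P :=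
    integrable_finsetSum _ hdev2
  have hmean : ∫ ω, ∑ t ∈ Finset.Icc 1 T, ∑ i', ∑ j,
      (lowerDev T α Δ H μ m X i' j t ω + upperDev T α Δ H μ m X i' j t ω) ∂P ≤
      N * K * (4 * α / Δ ^ 2 * (((T / H : ℕ) + 1) * (1 + Real.log T)) + 32 * α / Δ ^ 2) := by
    rw [integral_finsetSum _ hdev2]
    calc _ ≤ ∑ t ∈ Finset.Icc 1 T, ∑ _i : Fin N, ∑ _j : Fin K,
          (4 * α / Δ ^ 2 * (((t - 1) % H : ℕ) : ℝ)⁻¹ + 32 * α / Δ ^ 2 * (T : ℝ)⁻¹) := by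
          refine Finset.sum_le_sum fun t ht => ?_
          rw [integral_finsetSum _ fun i' _ => hdev1 t ht i']
          refine Finset.sum_le_sum fun i' _ => ?_
          rw [integral_finsetSum _ fun j _ => hdev t ht i' j]
          refine Finset.sum_le_sum fun j _ => ?_
          rw [integral_add (integrable_lowerDev hproc hα ht) (integrable_upperDev hproc hα ht)]
          exact add_le_add (integral_lowerDev_le hproc hα hΔ hσ ht)
            (integral_upperDev_le hproc hα hΔ hσ ht)
      _ = N * K * (4 * α / Δ ^ 2 * (∑ t ∈ Finset.Icc 1 T, (((t - 1) % H : ℕ) : ℝ)⁻¹) +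
          32 * α / Δ ^ 2) := by
          simp only [Finset.sum_const, Finset.card_univ, Fintype.card_fin, nsmul_eq_mul,
            ← Finset.mul_sum, Finset.sum_add_distrib, Nat.card_Icc, Nat.add_sub_cancel]
          field_simp
      _ ≤ _ := by
          gcongr
          exact sum_inv_mod_le hH hHT
  set A : ℝ := numChanges μ T * H + N * K * (((T / H : ℕ) + 1) * (sampleThreshold T α Δ + 1))
  set B : ℝ := ∑ t ∈ Finset.Icc 1 T, μ t i (b t i)
  have hrew : Integrable (fun ω => ∑ t ∈ Finset.Icc 1 T, μ t i (m t ω i)) P :=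
    integrable_finsetSum _ hint
  calc agentRegret P μ b m T i = ∫ ω, (B - ∑ t ∈ Finset.Icc 1 T, μ t i (m t ω i)) ∂P := by
        rw [integral_sub (integrable_const B) hrew]
        simp [agentRegret, B]
    _ ≤ ∫ ω, 2 * μbar * (A + ∑ t ∈ Finset.Icc 1 T, ∑ i', ∑ j,
          (lowerDev T α Δ H μ m X i' j t ω + upperDev T α Δ H μ m X i' j t ω)) ∂P := by
        refine integral_mono ((integrable_const B).sub hrew)
          (((integrable_const A).add hdev3).const_mul _) fun ω => ?_
        exact pathwise_regret_le hα hΔ hμ0 hH hbdd hgap hrun hb i ω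
    _ = 2 * μbar * (A + ∫ ω, ∑ t ∈ Finset.Icc 1 T, ∑ i', ∑ j,
          (lowerDev T α Δ H μ m X i' j t ω + upperDev T α Δ H μ m X i' j t ω) ∂P) := by
        rw [integral_const_mul, integral_add (integrable_const A) hdev3]
        simp
    _ ≤ _ := by gcongr

end Regret

/-! ### Tuning the restart period and assembling the bound. -/

/-- Consequences of the choice `H ≈ √(T / L)` of the restart period. -/
lemma restart_period_bounds {T L H : ℕ} {q : ℝ} (hL : 1 ≤ L) (hLT : (L : ℝ) ≤ q * T) (hq : 1 ≤ q)
    (hT : 2 ≤ T) (hH : 0 < H) (h : |(H : ℝ) - √((T : ℝ) / (L : ℝ))| < 1) :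
    H ≤ T ∧ (L : ℝ) * H ≤ (1 + q) * √((L : ℝ) * T) ∧
      ((T / H : ℕ) : ℝ) + 1 ≤ 3 * √((L : ℝ) * T) := by
  have hL' : (1 : ℝ) ≤ L := by exact_mod_cast hL
  have hT' : (2 : ℝ) ≤ T := by exact_mod_cast hT
  have hH' : (1 : ℝ) ≤ H := by exact_mod_cast hH
  rw [abs_lt] at h
  set x := √((T : ℝ) / (L : ℝ)) with hx
  set y := √((L : ℝ) * T) with hy
  have hx0 : 0 ≤ x := Real.sqrt_nonneg _
  have hy0 : 0 ≤ y := Real.sqrt_nonneg _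
  have hxx : x ^ 2 = T / L := Real.sq_sqrt (by positivity)
  have hyy : y ^ 2 = L * T := Real.sq_sqrt (by positivity)
  have hLx : L * x = y := by
    refine (pow_left_inj₀ (by positivity) hy0 two_ne_zero).1 ?_
    rw [mul_pow, hxx, hyy]; field_simp
  have hxy : x * y = T := by
    rw [← hLx, show x * (L * x) = L * x ^ 2 by ring, hxx]; field_simp
  -- From L² ≤ q·L·T ≤ q²·y². Rounding then costs L·H ≤ L·(x + 1) = y + L ≤ (1 + q)·y.
  have hLqy : (L : ℝ) ≤ q * y := by
    refine (pow_le_pow_iff_left₀ (by positivity) (by positivity) two_ne_zero).1 ?_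
    rw [mul_pow, hyy]
    nlinarith [mul_le_mul_of_nonneg_left hLT (show (0:ℝ) ≤ L by positivity),
      mul_nonneg (sub_nonneg.2 hq) (show (0:ℝ) ≤ q * (L * T) by positivity)]
  have hxT : x ^ 2 ≤ T := by rw [hxx]; exact div_le_self (by positivity) hL'
  have hy1 : 1 ≤ y := by
    rw [hy, Real.one_le_sqrt]; nlinarith
  refine ⟨?_, ?_, ?_⟩
  · by_contra hc
    have : (T : ℝ) + 1 ≤ H := by exact_mod_cast not_le.1 hc
    nlinarith
  · nlinarith
  -- Since x < H + 1 and H ≥ 1; hence T / H = x·y / H ≤ 2·y.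
  · have h1 : x ≤ 2 * H := by linarith
    have h2 : ((T / H : ℕ) : ℝ) ≤ 2 * y := by
      refine Nat.cast_div_le.trans ?_
      rw [div_le_iff₀ (by positivity), ← hxy]
      nlinarith
    linarith

end RCB

theorem theorem1 (N K : ℕ) (μbar α : ℝ) (hα : 0 < α) :
    ∃ C : ℝ, ∀ (T : ℕ) (Δ σ : ℝ) (π : Fin K → Fin N → ℝ) (μ : ℕ → Fin N → Fin K → ℝ),
      -- bounded mean rewards, uniform gap, at least one change, valid confidence parameter
      (∀ t ∈ Finset.Icc 1 T, ∀ i k, |μ t i k| ≤ μbar) →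
      0 < Δ →
      (∀ t ∈ Finset.Icc 1 T, ∀ i k k', k ≠ k' → Δ ≤ |μ t i k - μ t i k'|) →
      1 ≤ RCB.numChanges μ T →
      2 * σ ^ 2 ≤ α →
      -- the restart period, rounded to a positive integer
      ∀ H : ℕ, 0 < H → |(H : ℝ) - √((T : ℝ) / (RCB.numChanges μ T : ℝ))| < 1 →
      -- every run of the algorithm in this environment
      ∀ (Ω : Type*) [mΩ : MeasurableSpace Ω] (P : Measure Ω) [IsProbabilityMeasure P]
        (ℱ : Filtration ℕ mΩ) (r : ℕ → Ω → Fin N → Equiv.Perm (Fin K))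
        (m : ℕ → Ω → RCB.Matching N K) (X : ℕ → Fin N → Ω → ℝ),
      RCB.IsRewardProcess P ℱ T σ μ m X →
      RCB.IsRCBRun T α H π r m X →
      -- regret with respect to the player-pessimal stable matchings
      ∀ b : ℕ → RCB.Matching N K,
      (∀ t ∈ Finset.Icc 1 T, RCB.IsPlayerPessimal π (μ t) (b t)) →
      ∀ i : Fin N,
        RCB.agentRegret P μ b m T i
          ≤ C * √((RCB.numChanges μ T : ℝ) * (T : ℝ)) * (1 + 1 / Δ ^ 2) * (1 + Real.log T) := by
  -- The summands come from stale rounds, undersampled arms, low confidence bounds and high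
  -- empirical means, in this order. Each 3 is the bound on the number of intervals in units of
  -- √(LT).
  refine ⟨2 * μbar * ((1 + N * K) + N * K * (3 * (32 * α + 1) + 3 * (4 * α) + 32 * α)), ?_⟩
  intro T Δ σ π μ hbdd hΔ hgap hL hσ H hH hHT Ω mΩ P _ ℱ r m X hproc hrun b hb i
  have hNKT := RCB.numChanges_le μ T
  -- Changes are counted from round 2 on, so one change forces two rounds.
  have hT : 2 ≤ T := by
    by_contra hT
    rw [RCB.numChanges, Finset.Icc_eq_empty (by omega)] at hL
    simp at hL
  have hμ0 : 0 ≤ μbar := (abs_nonneg _).trans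
    (hbdd 1 (Finset.mem_Icc.2 ⟨le_rfl, by omega⟩) i (b 1 i))
  have hNK : 1 ≤ N * K := by
    rcases Nat.eq_zero_or_pos (N * K) with h | h
    · rw [h, zero_mul] at hNKT; omega
    · exact h
  obtain ⟨hHT', hLH, hTH⟩ := RCB.restart_period_bounds (q := N * K) hL (by exact_mod_cast hNKT)
    (by exact_mod_cast hNK) hT hH hHT
  refine (RCB.agentRegret_le hα hΔ hμ0 hH hHT' hbdd hgap hσ hproc hrun hb i).trans ?_
  have hy1 : 1 ≤ √((RCB.numChanges μ T : ℝ) * (T : ℝ)) := by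
    rw [Real.one_le_sqrt]
    exact_mod_cast Nat.mul_pos hL (by omega)
  have hlog : 0 ≤ Real.log T := Real.log_natCast_nonneg T
  rw [show RCB.sampleThreshold T α Δ = 32 * α * (1 / Δ ^ 2) * Real.log T by
    rw [RCB.sampleThreshold]; ring, show 4 * α / Δ ^ 2 = 4 * α * (1 / Δ ^ 2) by ring,
    show 32 * α / Δ ^ 2 = 32 * α * (1 / Δ ^ 2) by ring]
  set y := √((RCB.numChanges μ T : ℝ) * (T : ℝ))
  set d := 1 / Δ ^ 2 with hd
  have hd0 : 0 ≤ d := by positivity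
  set l := Real.log T
  set g := (1 + d) * (1 + l) with hg
  have hg1 : 1 ≤ g := by nlinarith [mul_nonneg hd0 hlog]
  have hdl : d * (1 + l) ≤ g := by nlinarith
  have hdg : d ≤ g := by nlinarith [mul_nonneg hd0 hlog]
  have e1 : (RCB.numChanges μ T : ℝ) * H ≤ (1 + N * K) * (y * g) := by
    refine hLH.trans (mul_le_mul_of_nonneg_left ?_ (by positivity))
    nlinarith
  have e2 : (((T / H : ℕ) : ℝ) + 1) * (32 * α * d * l + 1) ≤ 3 * y * ((32 * α + 1) * g) := by
    refine mul_le_mul hTH ?_ (by positivity) (by positivity)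
    nlinarith [mul_le_mul_of_nonneg_left hdl hα.le, mul_nonneg hα.le hd0]
  have e3 : 4 * α * d * ((((T / H : ℕ) : ℝ) + 1) * (1 + l)) ≤ 3 * y * (4 * α * g) := by
    calc _ = (((T / H : ℕ) : ℝ) + 1) * (4 * α * (d * (1 + l))) := by ring
      _ ≤ _ := by gcongr
  have e4 : 32 * α * d ≤ 32 * α * (y * g) := by
    refine mul_le_mul_of_nonneg_left ?_ (by positivity)
    nlinarith
  calc _ ≤ 2 * μbar * ((1 + N * K) * (y * g) + N * K * (3 * y * ((32 * α + 1) * g)) +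
        N * K * (3 * y * (4 * α * g) + 32 * α * (y * g))) := by gcongr
    _ = _ := by rw [hg]; ring
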